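/- Let $M,N,K\ge 1$ be integers and let $\Theta_{mn}$ ($1\le m\le M$, $1\le n\le N$) be i.i.d. random variables, uniform on $[0,2\pi)$. Let $A=[a_1,\dots,a_N]\in\mathbb C^{M\times N}$ be the random phase-rotated matrix with entries $A_{mn}=\frac1{\sqrt M}e^{j\Theta_{mn}}$. Let $x\in\mathbb C^N$ be a fixed vector with exactly $K$ nonzero entries, $S=\operatorname{supp}(x)$, and $y=Ax$. Orthogonal matching pursuit (OMP) starts from $S_0=\emptyset$, $r_0=y$. For $t=1,\dots,K$ it picks $i_t\in\operatorname{argmax}_{n\notin S_{t-1}}|a_n^*r_{t-1}|$, where ties are broken by an arbitrary fixed rule (one that depends only on $S_{t-1}$ and on the set of maximizers), sets $S_t=S_{t-1}\cup\{i_t\}$, lets $\hat x_t$ be a minimizer of $\|y-Az\|_2^2$ over all $z\in\mathbb C^N$ with $\operatorname{supp}(z)\subseteq S_t$, and sets $r_t=y-A\hat x_t$. It returns $\hat S=S_K$. Let $\mathcal V_{\mathrm{SSD}}$ be the event of successful support detection: $\hat S=S$, and in every iteration $t=1,\dots,K$ the greedy selection condition $\|A_{S^c}^*r_{t-1}\|_\infty<\|A_S^*r_{t-1}\|_\infty$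 holds, where $A_S$ and $A_{S^c}$ are the submatrices of the columns of $A$ indexed by $S$ and by its complement. Then, for every $g>2$, $$\Pr(\mathcal V_{\mathrm{SSD}})\ \ge\ 1-\Big(1-\frac2g\Big)^{-1/2}KN\,e^{-\frac{M}{gK^2}}.$$ Moreover, for every $g>2$ and $\epsilon\in(0,1)$, if $$M\ \ge\ gK^2\ln\!\bigg(\frac{KN}{\epsilon\sqrt{1-2/g}}\bigg),$$ then $\Pr(\mathcal V_{\mathrm{SSD}})\ge 1-\epsilon$. In particular, in both cases OMP recovers the support of $x$ with at least the stated probability. -/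

import Mathlib

open MeasureTheory ProbabilityTheory

noncomputable section

namespace RPR

/-- The random phase-rotated matrix with phases `θ`: its entries are `exp (j θ m n) / √M`. -/
def rprMatrix {M N : ℕ} (θ : Fin M → Fin N → ℝ) : Matrix (Fin M) (Fin N) ℂ :=
  Matrix.of fun m n => ((1 / √(M : ℝ) : ℝ) : ℂ) * Complex.exp (Complex.I * (θ m n : ℂ))

/-- The support of a vector. -/
def supp {N : ℕ} (x : Fin N → ℂ) : Finset (Fin N) :=
  Finset.univ.filter fun n => x n ≠ 0

/-- The Euclidean norm on `ℂ^M` (the norm that Mathlib puts on `Fin M → ℂ` is the sup norm). -/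
def l2norm {M : ℕ} (v : Fin M → ℂ) : ℝ := ‖(WithLp.toLp 2 v : EuclideanSpace ℂ (Fin M))‖

/-- The absolute correlation `|aₙ^* r|` of the `n`-th column of `A` with `r`. -/
def corr {M N : ℕ} (A : Matrix (Fin M) (Fin N) ℂ) (r : Fin M → ℂ) (n : Fin N) : ℝ :=
  ‖star (A.col n) ⬝ᵥ r‖

/-- The set of all maximizers of `|aₙ^* r|` over the indices `n` outside `T`. -/
def maximizers {M N : ℕ} (A : Matrix (Fin M) (Fin N) ℂ) (r : Fin M → ℂ) (T : Finset (Fin N)) :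
    Finset (Fin N) :=
  open Classical in Tᶜ.filter fun n => ∀ k ∈ Tᶜ, corr A r k ≤ corr A r n

/-- `z` minimizes `‖y - A z‖₂²` among the vectors supported in `T`. -/
def IsLeastSquares {M N : ℕ} (A : Matrix (Fin M) (Fin N) ℂ) (y : Fin M → ℂ)
    (T : Finset (Fin N)) (z : Fin N → ℂ) : Prop :=
  supp z ⊆ T ∧ ∀ w : Fin N → ℂ, supp w ⊆ T →
    l2norm (y - A.mulVec z) ^ 2 ≤ l2norm (y - A.mulVec w) ^ 2

theorem exists_isLeastSquares {M N : ℕ} (A : Matrix (Fin M) (Fin N) ℂ) (y : Fin M → ℂ)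
    (T : Finset (Fin N)) : ∃ z, IsLeastSquares A y T z := by
  let V : Submodule ℂ (Fin N → ℂ) :=
    { carrier := {z | supp z ⊆ T}
      add_mem' := by
        intro a b ha hb n hn
        by_contra h
        have h1 : a n = 0 := by
          by_contra h'; exact h (ha (by simp [supp, h']))
        have h2 : b n = 0 := by
          by_contra h'; exact h (hb (by simp [supp, h']))
        simp [supp, h1, h2] at hn
      zero_mem' := by intro n hn; simp [supp] at hn
      smul_mem' := by
        intro c a ha n hn
        apply ha
        simp only [supp, Finset.mem_filter, Finset.mem_univ, true_and, Pi.smul_apply,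
          smul_eq_mul] at hn ⊢
        exact right_ne_zero_of_mul hn }
  let L : (Fin N → ℂ) →ₗ[ℂ] EuclideanSpace ℂ (Fin M) :=
    (WithLp.linearEquiv 2 ℂ (Fin M → ℂ)).symm.toLinearMap ∘ₗ A.mulVecLin
  have hL : ∀ z, l2norm (y - A.mulVec z) = ‖WithLp.toLp 2 y - L z‖ := fun z => rfl
  let W := V.map L
  obtain ⟨z, hz, hzW⟩ := Submodule.mem_map.1 (W.starProjection_apply_mem (WithLp.toLp 2 y))
  refine ⟨z, hz, fun w hw => ?_⟩
  rw [hL, hL, hzW]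
  refine pow_le_pow_left₀ (norm_nonneg _) ?_ 2
  rw [Submodule.starProjection_minimal]
  exact ciInf_le ⟨0, by rintro _ ⟨u, rfl⟩; exact norm_nonneg _⟩
    (⟨L w, Submodule.mem_map_of_mem hw⟩ : W)

/-- A least squares estimate supported in `T`. (Where it is not unique, all of them have the
same image under `A`, so the residual does not depend on the choice.) -/
def lsEstimate {M N : ℕ} (A : Matrix (Fin M) (Fin N) ℂ) (y : Fin M → ℂ) (T : Finset (Fin N)) :
    Fin N → ℂ :=
  (exists_isLeastSquares A y T).choose

/-- A tie-breaking rule for the argmax: given the current active set and a nonempty set of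
maximizers, it names one of the maximizers. -/
def IsTieBreak {N : ℕ} (τ : Finset (Fin N) → Finset (Fin N) → Fin N) : Prop :=
  ∀ T s, s.Nonempty → τ T s ∈ s

/-- The active set `S_t` and the residual `r_t` of orthogonal matching pursuit after `t`
iterations. -/
def omp {M N : ℕ} (τ : Finset (Fin N) → Finset (Fin N) → Fin N)
    (A : Matrix (Fin M) (Fin N) ℂ) (y : Fin M → ℂ) : ℕ → Finset (Fin N) × (Fin M → ℂ)
  | 0 => (∅, y)
  | t + 1 =>
    let T := (omp τ A y t).1
    let r := (omp τ A y t).2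
    let i := τ T (maximizers A r T)
    let T' := insert i T
    (T', y - A.mulVec (lsEstimate A y T'))

/-- The greedy selection condition `‖A_{Sᶜ}^* r‖_∞ < ‖A_S^* r‖_∞`, that is, `ρ(r) < 1`. The
norms are the sup norms of functions on the index sets `Sᶜ` and `S`. -/
def GreedyCondition {M N : ℕ} (A : Matrix (Fin M) (Fin N) ℂ) (S : Finset (Fin N))
    (r : Fin M → ℂ) : Prop :=
  ‖(A.submatrix id (Subtype.val : {n // n ∉ S} → Fin N)).conjTranspose.mulVec r‖ <
    ‖(A.submatrix id (Subtype.val : {n // n ∈ S} → Fin N)).conjTranspose.mulVec r‖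

/-- Successful support detection: `K` iterations of orthogonal matching pursuit on `y = A x`
return exactly the support of `x`, and the greedy selection condition held in each of them. -/
def SSD {M N : ℕ} (τ : Finset (Fin N) → Finset (Fin N) → Fin N)
    (A : Matrix (Fin M) (Fin N) ℂ) (x : Fin N → ℂ) (K : ℕ) : Prop :=
  (omp τ A (A.mulVec x) K).1 = supp x ∧
    ∀ t < K, GreedyCondition A (supp x) (omp τ A (A.mulVec x) t).2

end RPR

end

noncomputable section

namespace RPR

open scoped NNReal ENNReal

/-! Deterministic half (`ssd_of_coherence`). Suppose the unit columns in S have pairwise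
correlations at most 1/K. Then r = ∑ c_i a_i over S satisfies ‖c‖₁ ≤ K‖r‖, and ‖r‖² ≤ ‖c‖₁ max_S
|a_i^* r| gives a column of S with correlation at least ‖r‖/K. If all outside columns stay below
‖r‖/K at every residual, OMP never leaves S; by orthogonality it never repeats an index, so K steps
exhaust S.

Decoupling. The residuals of OMP depend on all columns, so the outside condition is imposed on an
oracle pursuit in which the columns outside S are zeroed. Its residuals depend only on the columns
in S, and under the conditions above both pursuits coincide. What remains is one kind of bad event:
a column a_n has correlation at least ‖r‖/K with a nonzero r independent of it. K choices of r for
each n suffice, whence the factor KN.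

Tail bound. For fixed r, a_n^* r is a weighted sum Z of independent uniform phases, with squared
weights summing to L. Its real and imaginary parts are sub-Gaussian with proxy L/2, so E exp(l|Z|²)
≤ (1 - 2lL)^(-1/2), and Markov's inequality with l = 1/(gL) bounds each bad event. -/

/-! ### Exponential moments of squares -/

theorem lintegral_exp_mul_sq_gaussianReal {a : ℝ} (ha : 2 * a < 1) :
    ∫⁻ t, ENNReal.ofReal (Real.exp (a * t ^ 2)) ∂(gaussianReal 0 1) =
      ENNReal.ofReal ((1 - 2 * a) ^ (-(1 / 2) : ℝ)) := by
  have hb : 0 < 1 / 2 - a := by linarith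
  rw [gaussianReal_of_var_ne_zero 0 one_ne_zero,
    lintegral_withDensity_eq_lintegral_mul _ (measurable_gaussianPDF 0 1) (by fun_prop)]
  have h1 : ∀ t : ℝ, (gaussianPDF 0 1 * fun t => ENNReal.ofReal (Real.exp (a * t ^ 2))) t =
      ENNReal.ofReal ((√(2 * Real.pi))⁻¹ * Real.exp (-(1 / 2 - a) * t ^ 2)) := by
    intro t
    simp only [Pi.mul_apply, gaussianPDF, gaussianPDFReal]
    rw [← ENNReal.ofReal_mul (by positivity), mul_assoc, ← Real.exp_add]
    simp only [NNReal.coe_one, mul_one, sub_zero]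
    congr 3
    ring
  simp_rw [h1]
  rw [← ofReal_integral_eq_lintegral_ofReal
    ((integrable_exp_neg_mul_sq hb).const_mul _) (Filter.Eventually.of_forall fun t => by positivity),
    integral_const_mul, integral_gaussian]
  congr 1
  have hpi := Real.pi_pos
  rw [Real.rpow_neg (by linarith), ← Real.sqrt_eq_rpow, ← Real.sqrt_inv, ← Real.sqrt_inv,
    ← Real.sqrt_mul (by positivity)]
  congr 1
  have : 1 - 2 * a ≠ 0 := by linarith
  field_simp

theorem lintegral_exp_mul_gaussianReal (s : ℝ) :
    ∫⁻ t, ENNReal.ofReal (Real.exp (s * t)) ∂(gaussianReal 0 1) =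
      ENNReal.ofReal (Real.exp (s ^ 2 / 2)) := by
  rw [← ofReal_integral_eq_lintegral_ofReal (integrable_exp_mul_gaussianReal s)
    (Filter.Eventually.of_forall fun t => by positivity)]
  have := congrFun (mgf_id_gaussianReal (μ := 0) (v := 1)) s
  simp only [mgf, id] at this
  rw [this]
  simp

/-- A sub-Gaussian variable has the exponential square moments of the Gaussian bounding it. -/
theorem HasSubgaussianMGF.lintegral_exp_mul_sq_le {Ω : Type*} [MeasurableSpace Ω] {μ : Measure Ω}
    [SFinite μ] {X : Ω → ℝ} {c : ℝ≥0} (hX : HasSubgaussianMGF X c μ) (hm : Measurable X)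
    {l : ℝ} (hl : 0 ≤ l) (hcl : 2 * (c * l) < 1) :
    ∫⁻ ω, ENNReal.ofReal (Real.exp (l * X ω ^ 2)) ∂μ ≤
      ENNReal.ofReal ((1 - 2 * (c * l)) ^ (-(1 / 2) : ℝ)) := by
  rw [← lintegral_exp_mul_sq_gaussianReal hcl]
  -- Linearize the square: exp(lX²) is a Gaussian moment generating function at √(2l) X. After
  -- Tonelli only the moment generating function of X is needed.
  have h1 : ∀ ω, ENNReal.ofReal (Real.exp (l * X ω ^ 2)) =
      ∫⁻ t, ENNReal.ofReal (Real.exp (√(2 * l) * X ω * t)) ∂(gaussianReal 0 1) := by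
    intro ω
    rw [lintegral_exp_mul_gaussianReal, mul_pow, Real.sq_sqrt (by positivity)]
    congr 2
    ring
  simp_rw [h1]
  rw [lintegral_lintegral_swap (by fun_prop)]
  refine lintegral_mono fun t => ?_
  have h2 : ∀ ω, Real.exp (√(2 * l) * X ω * t) = Real.exp (√(2 * l) * t * X ω) := by
    intro ω; congr 1; ring
  simp_rw [h2]
  rw [← ofReal_integral_eq_lintegral_ofReal (hX.integrable_exp_mul _)
    (Filter.Eventually.of_forall fun t => by positivity)]
  refine ENNReal.ofReal_le_ofReal ((hX.mgf_le _).trans_eq ?_)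
  rw [mul_pow, Real.sq_sqrt (by positivity)]
  congr 1
  ring

/-! ### A uniform phase is sub-Gaussian -/

theorem cosh_add_cosh_le (c d : ℝ) :
    Real.cosh c + Real.cosh d ≤ 2 * Real.exp ((c ^ 2 + d ^ 2) / 4) := by
  have h : Real.cosh c + Real.cosh d =
      2 * (Real.cosh ((c + d) / 2) * Real.cosh ((c - d) / 2)) := by
    have h1 := Real.cosh_add ((c + d) / 2) ((c - d) / 2)
    have h2 := Real.cosh_sub ((c + d) / 2) ((c - d) / 2)
    rw [show (c + d) / 2 + (c - d) / 2 = c by ring] at h1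
    rw [show (c + d) / 2 - (c - d) / 2 = d by ring] at h2
    linarith
  rw [h, show (c ^ 2 + d ^ 2) / 4 = ((c + d) / 2) ^ 2 / 2 + ((c - d) / 2) ^ 2 / 2 by ring,
    Real.exp_add]
  gcongr
  · exact Real.cosh_le_exp_half_sq _
  · exact Real.cosh_le_exp_half_sq _

/-- This is I₀(s) ≤ exp(s²/4). Averaging the integrand over the four quarter turns of θ turns it
into cosh(s cos θ) + cosh(s sin θ), up to a factor 1/2, which is bounded pointwise. -/
theorem integral_exp_mul_cos_le (s α : ℝ) :
    ∫ θ in (0 : ℝ)..2 * Real.pi, Real.exp (s * Real.cos (θ - α)) ≤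
      2 * Real.pi * Real.exp (s ^ 2 / 4) := by
  set F : ℝ → ℝ := fun θ => Real.exp (s * Real.cos θ) with hF
  have hcont : Continuous F := by fun_prop
  have hper : Function.Periodic F (2 * Real.pi) := fun θ => by simp [hF]
  have hshift : ∀ b, ∫ θ in (0 : ℝ)..2 * Real.pi, F (θ + b) =
      ∫ θ in (0 : ℝ)..2 * Real.pi, F θ := by
    intro b
    rw [intervalIntegral.integral_comp_add_right (fun θ => F θ)]
    have := hper.intervalIntegral_add_eq b 0
    simpa [add_comm] using this
  have hα := hshift (-α)
  have hsum : ∫ θ in (0 : ℝ)..2 * Real.pi,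
      (F (θ + 0) + F (θ + Real.pi) + F (θ + Real.pi / 2) + F (θ + -(Real.pi / 2))) =
      4 * ∫ θ in (0 : ℝ)..2 * Real.pi, F θ := by
    have hi : ∀ b, IntervalIntegrable (fun θ => F (θ + b)) volume 0 (2 * Real.pi) := fun b =>
      (hcont.comp (continuous_add_const b)).intervalIntegrable _ _
    rw [intervalIntegral.integral_add (((hi _).add (hi _)).add (hi _)) (hi _),
      intervalIntegral.integral_add ((hi _).add (hi _)) (hi _),
      intervalIntegral.integral_add (hi _) (hi _), hshift, hshift, hshift, hshift]
    ring
  have hle : ∫ θ in (0 : ℝ)..2 * Real.pi,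
      (F (θ + 0) + F (θ + Real.pi) + F (θ + Real.pi / 2) + F (θ + -(Real.pi / 2))) ≤
      ∫ θ in (0 : ℝ)..2 * Real.pi, 4 * Real.exp (s ^ 2 / 4) := by
    refine intervalIntegral.integral_mono_on (by positivity) ?_ ?_ fun θ _ => ?_
    · exact Continuous.intervalIntegrable (by fun_prop) _ _
    · exact Continuous.intervalIntegrable (by fun_prop) _ _
    · have h := cosh_add_cosh_le (s * Real.cos θ) (s * Real.sin θ)
      have h2 : (s * Real.cos θ) ^ 2 + (s * Real.sin θ) ^ 2 = s ^ 2 := by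
        nlinarith [Real.sin_sq_add_cos_sq θ]
      rw [h2, Real.cosh_eq, Real.cosh_eq] at h
      simp only [hF, add_zero, Real.cos_add_pi, Real.cos_add_pi_div_two, ← sub_eq_add_neg,
        Real.cos_sub_pi_div_two, mul_neg]
      linarith
  rw [hsum, intervalIntegral.integral_const] at hle
  simp only [← sub_eq_add_neg] at hα
  rw [hα]
  simp only [sub_zero, smul_eq_mul] at hle
  linarith

theorem integral_comp_uniform {Ω : Type*} [MeasurableSpace Ω] {P : Measure Ω} {U : Ω → ℝ}
    (hm : Measurable U) (hU : pdf.IsUniform U (Set.Ico 0 (2 * Real.pi)) P volume)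
    {f : ℝ → ℝ} (hf : Continuous f) :
    ∫ ω, f (U ω) ∂P = (2 * Real.pi)⁻¹ * ∫ θ in (0 : ℝ)..2 * Real.pi, f θ := by
  have hpi : (0 : ℝ) ≤ 2 * Real.pi := by positivity
  rw [← integral_map hm.aemeasurable hf.aestronglyMeasurable, hU, ProbabilityTheory.cond,
    integral_smul_measure, intervalIntegral.integral_of_le hpi, integral_Ico_eq_integral_Ioc]
  simp [Real.volume_Ico, ENNReal.toReal_inv, ENNReal.toReal_ofReal Real.pi_pos.le]

theorem re_exp_mul (θ : ℝ) (v : ℂ) :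
    (star (Complex.exp (Complex.I * θ)) * v).re = ‖v‖ * Real.cos (θ - v.arg) := by
  rw [Real.cos_sub, mul_add, ← mul_assoc, ← mul_assoc, mul_comm ‖v‖ (Real.cos θ),
    mul_assoc, Complex.norm_mul_cos_arg, mul_comm ‖v‖ (Real.sin θ), mul_assoc,
    Complex.norm_mul_sin_arg, mul_comm Complex.I]
  simp [Complex.exp_ofReal_mul_I_re, Complex.exp_ofReal_mul_I_im]

/-- Boundedness by ‖v‖ alone would give the proxy ‖v‖²; the factor 1/2 is what allows every g > 2
rather than g > 4. -/
theorem hasSubgaussianMGF_re_phase {Ω : Type*} [MeasurableSpace Ω] {P : Measure Ω}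
    [IsProbabilityMeasure P] {U : Ω → ℝ}
    (hm : Measurable U) (hU : pdf.IsUniform U (Set.Ico 0 (2 * Real.pi)) P volume) (v : ℂ) :
    HasSubgaussianMGF (fun ω => (star (Complex.exp (Complex.I * U ω)) * v).re)
      (‖v‖₊ ^ 2 / 2) P := by
  simp_rw [re_exp_mul]
  constructor
  · intro t
    refine Integrable.of_bound (C := Real.exp (|t| * ‖v‖)) (by fun_prop)
      (Filter.Eventually.of_forall fun ω => ?_)
    rw [Real.norm_eq_abs, Real.abs_exp, Real.exp_le_exp]
    refine (le_abs_self _).trans ?_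
    rw [abs_mul, abs_mul, abs_norm]
    have := Real.abs_cos_le_one (U ω - v.arg)
    gcongr
    exact mul_le_of_le_one_right (norm_nonneg _) this
  · intro t
    have h := integral_comp_uniform hm hU
      (f := fun θ => Real.exp (t * ‖v‖ * Real.cos (θ - v.arg))) (by fun_prop)
    have h2 := integral_exp_mul_cos_le (t * ‖v‖) v.arg
    have hpi := Real.pi_pos
    simp only [mgf, ← mul_assoc]
    rw [h, inv_mul_le_iff₀ (by positivity)]
    refine h2.trans_eq ?_
    congr 2
    push_cast
    ring

/-! ### Tails of weighted sums of random phases -/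

theorem lintegral_exp_sq_re_sum_phase_le {Ω : Type*} [MeasurableSpace Ω] {P : Measure Ω}
    [IsProbabilityMeasure P] {ι : Type*} [Fintype ι] {U : ι → Ω → ℝ} (hm : ∀ i, Measurable (U i))
    (hU : ∀ i, pdf.IsUniform (U i) (Set.Ico 0 (2 * Real.pi)) P volume) (hind : iIndepFun U P)
    (v : ι → ℂ) {l : ℝ} (hl : 0 ≤ l) (hvl : 2 * (l * ∑ i, ‖v i‖ ^ 2) < 1) :
    ∫⁻ ω, ENNReal.ofReal (Real.exp
        (2 * l * (∑ i, star (Complex.exp (Complex.I * U i ω)) * v i).re ^ 2)) ∂P ≤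
      ENNReal.ofReal ((1 - 2 * (l * ∑ i, ‖v i‖ ^ 2)) ^ (-(1 / 2) : ℝ)) := by
  have hsub := HasSubgaussianMGF.sum_of_iIndepFun (s := Finset.univ)
    (hind.comp (fun i θ => (star (Complex.exp (Complex.I * (θ : ℂ))) * v i).re)
      fun i => by fun_prop)
    fun i _ => hasSubgaussianMGF_re_phase (hm i) (hU i) (v i)
  have hc : 2 * (((∑ i, ‖v i‖₊ ^ 2 / 2 : ℝ≥0) : ℝ) * (2 * l)) = 2 * (l * ∑ i, ‖v i‖ ^ 2) := by
    push_cast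
    rw [← Finset.sum_div]
    ring
  have h := HasSubgaussianMGF.lintegral_exp_mul_sq_le hsub
    (by simp only [Function.comp_def]; fun_prop)
    (l := 2 * l) (by positivity) (by rw [hc]; exact hvl)
  rw [hc] at h
  simpa only [Complex.re_sum, Function.comp_def] using h

/-- The real and imaginary parts X, Y of the sum may be dependent; exp(lX²) exp(lY²) ≤ (exp(2lX²) +
exp(2lY²))/2 separates them. -/
theorem lintegral_exp_norm_sq_sum_phase_le {Ω : Type*} [MeasurableSpace Ω] {P : Measure Ω}
    [IsProbabilityMeasure P] {ι : Type*} [Fintype ι] {U : ι → Ω → ℝ} (hm : ∀ i, Measurable (U i))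
    (hU : ∀ i, pdf.IsUniform (U i) (Set.Ico 0 (2 * Real.pi)) P volume) (hind : iIndepFun U P)
    (v : ι → ℂ) {l : ℝ} (hl : 0 ≤ l) (hvl : 2 * (l * ∑ i, ‖v i‖ ^ 2) < 1) :
    ∫⁻ ω, ENNReal.ofReal (Real.exp
        (l * ‖∑ i, star (Complex.exp (Complex.I * U i ω)) * v i‖ ^ 2)) ∂P ≤
      ENNReal.ofReal ((1 - 2 * (l * ∑ i, ‖v i‖ ^ 2)) ^ (-(1 / 2) : ℝ)) := by
  set C := ENNReal.ofReal ((1 - 2 * (l * ∑ i, ‖v i‖ ^ 2)) ^ (-(1 / 2) : ℝ)) with hC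
  set Z : Ω → ℂ := fun ω => ∑ i, star (Complex.exp (Complex.I * U i ω)) * v i with hZ
  have hre := lintegral_exp_sq_re_sum_phase_le hm hU hind v hl hvl
  -- Rotating the weights by -i makes the imaginary part a real part.
  have him := lintegral_exp_sq_re_sum_phase_le hm hU hind (fun i => -Complex.I * v i) hl
    (by simpa using hvl)
  have hZi : ∀ ω, (∑ i, star (Complex.exp (Complex.I * U i ω)) * (-Complex.I * v i)).re =
      (Z ω).im := by
    intro ω
    have : ∑ i, star (Complex.exp (Complex.I * U i ω)) * (-Complex.I * v i) =
        -Complex.I * Z ω := by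
      rw [hZ, Finset.mul_sum]
      exact Finset.sum_congr rfl fun i _ => by ring
    rw [this]
    simp
  simp only [hZi, norm_mul, norm_neg, Complex.norm_I, one_mul] at him
  have hZm : Measurable Z := by fun_prop
  calc ∫⁻ ω, ENNReal.ofReal (Real.exp (l * ‖Z ω‖ ^ 2)) ∂P
      ≤ ∫⁻ ω, 2⁻¹ * (ENNReal.ofReal (Real.exp (2 * l * (Z ω).re ^ 2)) +
          ENNReal.ofReal (Real.exp (2 * l * (Z ω).im ^ 2))) ∂P := by
        refine lintegral_mono fun ω => ?_
        rw [← ENNReal.ofReal_add (by positivity) (by positivity),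
          show (2⁻¹ : ℝ≥0∞) = ENNReal.ofReal 2⁻¹ by
            rw [ENNReal.ofReal_inv_of_pos two_pos]; simp,
          ← ENNReal.ofReal_mul (by positivity)]
        refine ENNReal.ofReal_le_ofReal ?_
        have e1 : Real.exp (l * ‖Z ω‖ ^ 2) =
            Real.exp (l * (Z ω).re ^ 2) * Real.exp (l * (Z ω).im ^ 2) := by
          rw [← Real.exp_add, Complex.sq_norm, Complex.normSq_apply]
          congr 1
          ring
        have e2 : ∀ y : ℝ, Real.exp (2 * l * y ^ 2) = Real.exp (l * y ^ 2) ^ 2 := by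
          intro y
          rw [← Real.exp_nat_mul]
          congr 1
          push_cast
          ring
        rw [e1, e2, e2]
        nlinarith [sq_nonneg (Real.exp (l * (Z ω).re ^ 2) - Real.exp (l * (Z ω).im ^ 2))]
    _ ≤ 2⁻¹ * (C + C) := by
        rw [lintegral_const_mul _ (by fun_prop), lintegral_add_left (by fun_prop)]
        gcongr
    _ = C := by
        rw [← two_mul, ← mul_assoc, ENNReal.inv_mul_cancel two_ne_zero ENNReal.ofNat_ne_top,
          one_mul]

/-- Tail bound for the correlation of a random phase column with a fixed nonzero vector. -/
theorem measure_norm_sum_phase_ge_le {Ω : Type*} [MeasurableSpace Ω] {P : Measure Ω}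
    [IsProbabilityMeasure P] {ι : Type*} [Fintype ι] {U : ι → Ω → ℝ} (hm : ∀ i, Measurable (U i))
    (hU : ∀ i, pdf.IsUniform (U i) (Set.Ico 0 (2 * Real.pi)) P volume) (hind : iIndepFun U P)
    (v : ι → ℂ) {g δ : ℝ} (hg : 2 < g) (hδ : 0 ≤ δ) (hv : 0 < ∑ i, ‖v i‖ ^ 2) :
    P {ω | δ * √(∑ i, ‖v i‖ ^ 2) ≤ ‖∑ i, star (Complex.exp (Complex.I * U i ω)) * v i‖} ≤
      ENNReal.ofReal ((1 - 2 / g) ^ (-(1 / 2) : ℝ) * Real.exp (-(δ ^ 2 / g))) := by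
  set L := ∑ i, ‖v i‖ ^ 2 with hL
  have hg0 : 0 < g := by linarith
  have hlL : 2 * ((g * L)⁻¹ * L) = 2 / g := by field_simp
  -- With l = 1/(gL) the moment bound is (1 - 2/g)^(-1/2), and Markov's threshold is exp(δ²/g).
  have h := lintegral_exp_norm_sq_sum_phase_le hm hU hind v (l := (g * L)⁻¹) (by positivity)
    (by rw [hlL, div_lt_one hg0]; exact hg)
  rw [hlL] at h
  have hexp : 0 < Real.exp (δ ^ 2 / g) := Real.exp_pos _
  have hmark := meas_ge_le_lintegral_div (μ := P)
    (f := fun ω => ENNReal.ofReal (Real.exp ((g * L)⁻¹ *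
      ‖∑ i, star (Complex.exp (Complex.I * U i ω)) * v i‖ ^ 2))) (by fun_prop)
    (ε := ENNReal.ofReal (Real.exp (δ ^ 2 / g))) (by simpa using hexp) (by simp)
  refine (measure_mono fun ω hω => ?_).trans (hmark.trans ?_)
  · refine ENNReal.ofReal_le_ofReal (Real.exp_le_exp.2 ?_)
    have h1 : (δ * √L) ^ 2 ≤ ‖∑ i, star (Complex.exp (Complex.I * U i ω)) * v i‖ ^ 2 :=
      pow_le_pow_left₀ (by positivity) hω 2
    rw [mul_pow, Real.sq_sqrt hv.le] at h1
    rw [inv_mul_eq_div, div_le_div_iff₀ hg0 (by positivity)]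
    nlinarith
  · rw [Real.exp_neg, ← div_eq_mul_inv, ENNReal.ofReal_div_of_pos hexp]
    gcongr

/-! ### Least squares residuals as projections -/

variable {M N : ℕ}

/-- The `n`-th column of `A` as a vector of Euclidean space. -/
def ecol (A : Matrix (Fin M) (Fin N) ℂ) (n : Fin N) : EuclideanSpace ℂ (Fin M) :=
  WithLp.toLp 2 (A.col n)

/-- The span of the columns of `A` with indices in `T`. -/
def colSpan (A : Matrix (Fin M) (Fin N) ℂ) (T : Finset (Fin N)) :
    Submodule ℂ (EuclideanSpace ℂ (Fin M)) :=
  Submodule.span ℂ (ecol A '' T)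

theorem corr_eq_norm_inner (A : Matrix (Fin M) (Fin N) ℂ) (r : Fin M → ℂ) (n : Fin N) :
    corr A r n = ‖inner ℂ (ecol A n) (WithLp.toLp 2 r)‖ := by
  rw [corr, ecol, EuclideanSpace.inner_toLp_toLp, dotProduct_comm]

theorem mem_supp {x : Fin N → ℂ} {n : Fin N} : n ∈ supp x ↔ x n ≠ 0 := by simp [supp]

theorem eq_zero_of_supp_subset {z : Fin N → ℂ} {T : Finset (Fin N)} (hz : supp z ⊆ T)
    {n : Fin N} (hn : n ∉ T) : z n = 0 := by
  by_contra h
  exact hn (hz (mem_supp.2 h))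

theorem toLp_mulVec (A : Matrix (Fin M) (Fin N) ℂ) {T : Finset (Fin N)} {z : Fin N → ℂ}
    (hz : supp z ⊆ T) : WithLp.toLp 2 (A.mulVec z) = ∑ n ∈ T, z n • ecol A n := by
  have h : ∑ n ∈ T, z n • ecol A n = ∑ n, z n • ecol A n :=
    Finset.sum_subset (Finset.subset_univ _) fun n _ hn => by
      rw [eq_zero_of_supp_subset hz hn, zero_smul]
  rw [h]
  ext m
  simp [ecol, Matrix.mulVec, dotProduct, mul_comm]

theorem toLp_mulVec_mem_colSpan (A : Matrix (Fin M) (Fin N) ℂ) {T : Finset (Fin N)}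
    {z : Fin N → ℂ} (hz : supp z ⊆ T) : WithLp.toLp 2 (A.mulVec z) ∈ colSpan A T := by
  rw [toLp_mulVec A hz]
  exact Submodule.sum_mem _ fun n hn =>
    Submodule.smul_mem _ _ (Submodule.subset_span ⟨n, hn, rfl⟩)

theorem exists_of_mem_colSpan {A : Matrix (Fin M) (Fin N) ℂ} {T : Finset (Fin N)}
    {u : EuclideanSpace ℂ (Fin M)} (hu : u ∈ colSpan A T) :
    ∃ z, supp z ⊆ T ∧ WithLp.toLp 2 (A.mulVec z) = u := by
  obtain ⟨c, rfl⟩ := (Submodule.mem_span_image_finset_iff_exists_fun' ℂ).1 hu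
  have hs : supp (fun n => if n ∈ T then c n else 0) ⊆ T := fun n hn => by
    by_contra h
    simp [mem_supp, h] at hn
  refine ⟨_, hs, ?_⟩
  rw [toLp_mulVec A hs]
  exact Finset.sum_congr rfl fun n hn => by simp [hn]

/-- The residual of the orthogonal projection of `y` onto the columns with indices in `T`. -/
def lsResidual (A : Matrix (Fin M) (Fin N) ℂ) (T : Finset (Fin N))
    (u : EuclideanSpace ℂ (Fin M)) : EuclideanSpace ℂ (Fin M) :=
  u - (colSpan A T).starProjection u

/-- A minimizer attains the distance to the column span, so its image is the orthogonal projection.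
The arbitrary choice in `lsEstimate` thus leaves no trace in the residual. -/
theorem IsLeastSquares.toLp_residual {A : Matrix (Fin M) (Fin N) ℂ} {y : Fin M → ℂ}
    {T : Finset (Fin N)} {z : Fin N → ℂ} (hz : IsLeastSquares A y T z) :
    WithLp.toLp 2 (y - A.mulVec z) = lsResidual A T (WithLp.toLp 2 y) := by
  have hmem := toLp_mulVec_mem_colSpan A hz.1
  have hmin : ‖WithLp.toLp 2 y - WithLp.toLp 2 (A.mulVec z)‖ =
      ⨅ w : colSpan A T, ‖WithLp.toLp 2 y - (w : EuclideanSpace ℂ (Fin M))‖ := by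
    refine le_antisymm (le_ciInf fun w => ?_)
      (ciInf_le ⟨0, by rintro _ ⟨u, rfl⟩; exact norm_nonneg _⟩
        (⟨_, hmem⟩ : colSpan A T))
    obtain ⟨w', hw', hw⟩ := exists_of_mem_colSpan w.2
    have := hz.2 w' hw'
    rw [← hw]
    exact le_of_sq_le_sq this (norm_nonneg _)
  rw [lsResidual, Submodule.eq_starProjection_of_mem_of_inner_eq_zero hmem
    ((Submodule.norm_eq_iInf_iff_inner_eq_zero _ hmem).1 hmin)]
  rfl

theorem toLp_omp_snd (τ : Finset (Fin N) → Finset (Fin N) → Fin N)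
    (A : Matrix (Fin M) (Fin N) ℂ) (y : Fin M → ℂ) (t : ℕ) :
    WithLp.toLp 2 (omp τ A y t).2 = lsResidual A (omp τ A y t).1 (WithLp.toLp 2 y) := by
  cases t with
  | zero => simp [omp, lsResidual, colSpan]
  | succ t => exact (exists_isLeastSquares A y _).choose_spec.toLp_residual

/-! ### Coherence estimates on the support -/

/-- Columns that are nearly orthogonal control the `ℓ¹` norm of their coefficients. -/
theorem sum_norm_le_of_coherence {A : Matrix (Fin M) (Fin N) ℂ} {S : Finset (Fin N)}
    (hunit : ∀ n, ‖ecol A n‖ = 1)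
    (hcoh : ∀ i ∈ S, ∀ k ∈ S, i ≠ k → ‖inner ℂ (ecol A i) (ecol A k)‖ ≤ 1 / S.card)
    (c : Fin N → ℂ) :
    ∑ i ∈ S, ‖c i‖ ≤ S.card * ‖∑ i ∈ S, c i • ecol A i‖ := by
  rcases S.eq_empty_or_nonempty with rfl | hS
  · simp
  have hK : (0 : ℝ) < S.card := by exact_mod_cast hS.card_pos
  set K : ℝ := (S.card : ℝ) with hKdef
  set v := ∑ i ∈ S, c i • ecol A i with hv
  -- Bounding the diagonal in the same form as the off-diagonal lets the double sum collapse to (1 +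
  -- 1/K) ∑‖c_i‖² - (∑‖c_i‖)²/K.
  have hterm : ∀ i ∈ S, ∀ k ∈ S,
      (if i = k then (1 + 1 / K) * ‖c i‖ ^ 2 else 0) - 1 / K * (‖c i‖ * ‖c k‖) ≤
        RCLike.re (inner ℂ (c i • ecol A i) (c k • ecol A k)) := by
    intro i hi k hk
    split_ifs with hik
    · subst hik
      rw [inner_self_eq_norm_sq, norm_smul, hunit, mul_one]
      apply le_of_eq
      ring
    · have h1 : ‖inner ℂ (c i • ecol A i) (c k • ecol A k)‖ ≤ 1 / K * (‖c i‖ * ‖c k‖) := by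
        rw [inner_smul_left, inner_smul_right, norm_mul, norm_mul, RCLike.norm_conj]
        have := hcoh i hi k hk hik
        nlinarith [mul_nonneg (norm_nonneg (c i)) (norm_nonneg (c k))]
      have h2 := (abs_le.1 ((RCLike.abs_re_le_norm _).trans h1)).1
      linarith
  have hnorm : ‖v‖ ^ 2 = ∑ i ∈ S, ∑ k ∈ S,
      RCLike.re (inner ℂ (c i • ecol A i) (c k • ecol A k)) := by
    rw [← inner_self_eq_norm_sq (𝕜 := ℂ), hv, sum_inner]
    simp_rw [inner_sum, map_sum]
  have hsum : (1 + 1 / K) * ∑ i ∈ S, ‖c i‖ ^ 2 - 1 / K * (∑ i ∈ S, ‖c i‖) ^ 2 ≤ ‖v‖ ^ 2 := by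
    rw [hnorm]
    refine le_trans (le_of_eq ?_)
      (Finset.sum_le_sum fun i hi => Finset.sum_le_sum fun k hk => hterm i hi k hk)
    simp_rw [Finset.sum_sub_distrib, Finset.sum_ite_eq]
    rw [sq, Finset.sum_mul_sum, Finset.mul_sum, Finset.mul_sum]
    congr 1
    · exact Finset.sum_congr rfl fun i hi => by simp [hi]
    · simp_rw [Finset.mul_sum]
  have hcs : (∑ i ∈ S, ‖c i‖) ^ 2 ≤ K * ∑ i ∈ S, ‖c i‖ ^ 2 := sq_sum_le_card_mul_sum_sq
  set a := ∑ i ∈ S, ‖c i‖ with ha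
  set b := ∑ i ∈ S, ‖c i‖ ^ 2
  refine le_of_sq_le_sq ?_ (by positivity)
  rw [mul_pow]
  -- By Cauchy–Schwarz a² ≤ Kb, so (K + 1)Kb - Ka² ≥ a².
  have h1 : K ^ 2 * ((1 + 1 / K) * b - 1 / K * a ^ 2) ≤ K ^ 2 * ‖v‖ ^ 2 := by gcongr
  have h2 : K ^ 2 * ((1 + 1 / K) * b - 1 / K * a ^ 2) = (K + 1) * (K * b) - K * a ^ 2 := by
    field_simp
  nlinarith

/-- A combination of nearly orthogonal columns correlates with one of them. -/
theorem exists_norm_le_corr_of_coherence {A : Matrix (Fin M) (Fin N) ℂ} {S : Finset (Fin N)}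
    (hunit : ∀ n, ‖ecol A n‖ = 1)
    (hcoh : ∀ i ∈ S, ∀ k ∈ S, i ≠ k → ‖inner ℂ (ecol A i) (ecol A k)‖ ≤ 1 / S.card)
    (hS : S.Nonempty) {r : Fin M → ℂ} {c : Fin N → ℂ}
    (hr : WithLp.toLp 2 r = ∑ i ∈ S, c i • ecol A i) :
    ∃ i ∈ S, l2norm r / S.card ≤ corr A r i := by
  obtain ⟨i, hi, hmax⟩ := S.exists_max_image (corr A r) hS
  refine ⟨i, hi, ?_⟩
  have hK : (0 : ℝ) < S.card := by exact_mod_cast hS.card_pos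
  have h1 := sum_norm_le_of_coherence hunit hcoh c
  rw [← hr] at h1
  change _ ≤ _ * l2norm r at h1
  have hcorr0 : 0 ≤ corr A r i := norm_nonneg _
  have h2 : l2norm r ^ 2 ≤ (∑ k ∈ S, ‖c k‖) * corr A r i := by
    have e : l2norm r ^ 2 = ‖inner ℂ (WithLp.toLp 2 r) (WithLp.toLp 2 r)‖ := by
      rw [inner_self_eq_norm_sq_to_K, norm_pow, RCLike.norm_ofReal, abs_norm, l2norm]
    rw [e]
    nth_rewrite 1 [hr]
    rw [sum_inner, Finset.sum_mul]
    refine (norm_sum_le _ _).trans (Finset.sum_le_sum fun k hk => ?_)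
    rw [inner_smul_left, norm_mul, RCLike.norm_conj, ← corr_eq_norm_inner]
    exact mul_le_mul_of_nonneg_left (hmax k hk) (norm_nonneg _)
  rcases (norm_nonneg (WithLp.toLp 2 r)).eq_or_lt with h0 | h0
  · change 0 = l2norm r at h0
    rw [← h0, zero_div]
    exact hcorr0
  · change 0 < l2norm r at h0
    rw [div_le_iff₀ hK]
    refine le_of_mul_le_mul_right ?_ h0
    nlinarith [mul_le_mul_of_nonneg_right h1 hcorr0]

/-! ### Comparison with the oracle pursuit -/

/-- The matrix `A` with the columns outside `S` replaced by zero. -/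
def restrictCols (S : Finset (Fin N)) (A : Matrix (Fin M) (Fin N) ℂ) :
    Matrix (Fin M) (Fin N) ℂ :=
  Matrix.of fun m n => if n ∈ S then A m n else 0

theorem restrictCols_mulVec (A : Matrix (Fin M) (Fin N) ℂ) {S : Finset (Fin N)}
    {z : Fin N → ℂ} (hz : supp z ⊆ S) : (restrictCols S A).mulVec z = A.mulVec z := by
  ext m
  simp only [Matrix.mulVec, dotProduct]
  refine Finset.sum_congr rfl fun n _ => ?_
  by_cases hn : n ∈ S
  · simp [restrictCols, hn]
  · simp [eq_zero_of_supp_subset hz hn]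

theorem ecol_restrictCols (A : Matrix (Fin M) (Fin N) ℂ) {S : Finset (Fin N)} {n : Fin N}
    (hn : n ∈ S) : ecol (restrictCols S A) n = ecol A n := by
  ext m
  simp [ecol, restrictCols, hn]

theorem corr_restrictCols_of_mem (A : Matrix (Fin M) (Fin N) ℂ) (r : Fin M → ℂ)
    {S : Finset (Fin N)} {n : Fin N} (hn : n ∈ S) : corr (restrictCols S A) r n = corr A r n := by
  rw [corr_eq_norm_inner, corr_eq_norm_inner, ecol_restrictCols A hn]

theorem corr_restrictCols_of_notMem (A : Matrix (Fin M) (Fin N) ℂ) (r : Fin M → ℂ)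
    {S : Finset (Fin N)} {n : Fin N} (hn : n ∉ S) : corr (restrictCols S A) r n = 0 := by
  have : ecol (restrictCols S A) n = 0 := by
    ext m
    simp [ecol, restrictCols, hn]
  rw [corr_eq_norm_inner, this, inner_zero_left, norm_zero]

theorem colSpan_restrictCols (A : Matrix (Fin M) (Fin N) ℂ) {S T : Finset (Fin N)}
    (hT : T ⊆ S) : colSpan (restrictCols S A) T = colSpan A T := by
  rw [colSpan, colSpan, Set.image_congr fun n hn => ecol_restrictCols A (hT hn)]

theorem lsResidual_restrictCols (A : Matrix (Fin M) (Fin N) ℂ) {S T : Finset (Fin N)}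
    (hT : T ⊆ S) (u : EuclideanSpace ℂ (Fin M)) :
    lsResidual (restrictCols S A) T u = lsResidual A T u := by
  simp only [lsResidual, colSpan_restrictCols A hT]

theorem mem_maximizers {A : Matrix (Fin M) (Fin N) ℂ} {r : Fin M → ℂ} {T : Finset (Fin N)}
    {n : Fin N} : n ∈ maximizers A r T ↔ n ∉ T ∧ ∀ k ∉ T, corr A r k ≤ corr A r n := by
  simp [maximizers]

theorem maximizers_nonempty (A : Matrix (Fin M) (Fin N) ℂ) (r : Fin M → ℂ) {T : Finset (Fin N)}
    {i : Fin N} (hi : i ∉ T) : (maximizers A r T).Nonempty := by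
  obtain ⟨n, hn, hmax⟩ := Tᶜ.exists_max_image (corr A r) ⟨i, by simpa using hi⟩
  exact ⟨n, mem_maximizers.2 ⟨by simpa using hn, fun k hk => hmax k (by simpa using hk)⟩⟩

theorem maximizers_subset {A : Matrix (Fin M) (Fin N) ℂ} {r : Fin M → ℂ} {S T : Finset (Fin N)}
    {i : Fin N} (hiT : i ∉ T) (hlt : ∀ n ∉ S, corr A r n < corr A r i) :
    maximizers A r T ⊆ S := by
  intro n hn
  by_contra h
  exact absurd ((mem_maximizers.1 hn).2 i hiT) (not_le.2 (hlt n h))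

/-- Zeroed columns have correlation 0 and so cannot win either. The whole set of maximizers must
agree, because the tie-break may depend on it. -/
theorem maximizers_restrictCols {A : Matrix (Fin M) (Fin N) ℂ} {r : Fin M → ℂ}
    {S T : Finset (Fin N)} {i : Fin N} (hiS : i ∈ S) (hiT : i ∉ T)
    (hlt : ∀ n ∉ S, corr A r n < corr A r i) :
    maximizers (restrictCols S A) r T = maximizers A r T := by
  have hsub := maximizers_subset hiT hlt
  have hsub' : maximizers (restrictCols S A) r T ⊆ S := by
    refine maximizers_subset hiT fun n hn => ?_
    rw [corr_restrictCols_of_notMem A r hn, corr_restrictCols_of_mem A r hiS]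
    exact (norm_nonneg _).trans_lt (hlt n hn)
  ext n
  constructor
  · intro hn
    have hnS := hsub' hn
    rw [mem_maximizers] at hn ⊢
    refine ⟨hn.1, fun k hk => ?_⟩
    rw [← corr_restrictCols_of_mem A r hnS]
    by_cases hkS : k ∈ S
    · rw [← corr_restrictCols_of_mem A r hkS]
      exact hn.2 k hk
    · refine (hlt k hkS).le.trans ?_
      rw [← corr_restrictCols_of_mem A r hiS]
      exact hn.2 i hiT
  · intro hn
    have hnS := hsub hn
    rw [mem_maximizers] at hn ⊢
    refine ⟨hn.1, fun k hk => ?_⟩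
    rw [corr_restrictCols_of_mem A r hnS]
    by_cases hkS : k ∈ S
    · rw [corr_restrictCols_of_mem A r hkS]
      exact hn.2 k hk
    · rw [corr_restrictCols_of_notMem A r hkS]
      exact norm_nonneg _

theorem greedyCondition_of_corr_lt {A : Matrix (Fin M) (Fin N) ℂ} {r : Fin M → ℂ}
    {S : Finset (Fin N)} {i : Fin N} (hiS : i ∈ S) (hpos : 0 < corr A r i)
    (hlt : ∀ n ∉ S, corr A r n < corr A r i) : GreedyCondition A S r := by
  refine lt_of_lt_of_le ((pi_norm_lt_iff hpos).2 fun n => hlt n n.2) ?_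
  exact norm_le_pi_norm
    ((A.submatrix id (Subtype.val : {n // n ∈ S} → Fin N)).conjTranspose.mulVec r) ⟨i, hiS⟩

/-- If the support is nearly orthogonal and no outside column correlates too much with the
residuals of the pursuit restricted to the support, then the pursuit detects the support. -/
theorem ssd_of_coherence {τ : Finset (Fin N) → Finset (Fin N) → Fin N} (hτ : IsTieBreak τ)
    {A : Matrix (Fin M) (Fin N) ℂ} {x : Fin N → ℂ} (hunit : ∀ n, ‖ecol A n‖ = 1)
    (hcoh : ∀ i ∈ supp x, ∀ k ∈ supp x, i ≠ k →
      ‖inner ℂ (ecol A i) (ecol A k)‖ ≤ 1 / (supp x).card)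
    (hout : ∀ t < (supp x).card, ∀ n ∉ supp x, ∀ r,
      r = (omp τ (restrictCols (supp x) A) ((restrictCols (supp x) A).mulVec x) t).2 →
      0 < l2norm r → corr A r n < l2norm r / (supp x).card) :
    SSD τ A x (supp x).card := by
  set S := supp x with hS
  set y := A.mulVec x with hy
  rw [restrictCols_mulVec A subset_rfl] at hout
  have hgreedy : ∀ t < S.card, omp τ A y t = omp τ (restrictCols S A) y t →
      (omp τ A y t).1 ⊆ S → (omp τ A y t).1.card = t →
      ∃ i ∈ S, i ∉ (omp τ A y t).1 ∧ 0 < corr A (omp τ A y t).2 i ∧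
        ∀ n ∉ S, corr A (omp τ A y t).2 n < corr A (omp τ A y t).2 i := by
    intro t ht heq hsub hcard
    have hres := toLp_omp_snd τ A y t
    set T := (omp τ A y t).1 with hT
    set r := (omp τ A y t).2 with hr
    obtain ⟨j, hjS, hjT⟩ := Finset.exists_mem_notMem_of_card_lt_card (hcard.trans_lt ht)
    obtain ⟨z, hz, hzp⟩ := exists_of_mem_colSpan
      ((colSpan A T).starProjection_apply_mem (WithLp.toLp 2 y))
    have hrc : WithLp.toLp 2 r = ∑ i ∈ S, (x - z) i • ecol A i := by
      rw [hres, lsResidual, ← hzp, hy, toLp_mulVec A (hz.trans hsub),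
        toLp_mulVec A (T := S) subset_rfl, ← Finset.sum_sub_distrib]
      exact Finset.sum_congr rfl fun i _ => (sub_smul _ _ _).symm
    have hpos : 0 < l2norm r := by
      have h1 := sum_norm_le_of_coherence hunit hcoh (x - z)
      rw [← hrc] at h1
      change _ ≤ _ * l2norm r at h1
      -- An index j of S not yet selected keeps its coefficient x_j ≠ 0, so the residual cannot
      -- vanish.
      have h2 : 0 < ∑ i ∈ S, ‖(x - z) i‖ := by
        refine Finset.sum_pos' (fun _ _ => norm_nonneg _) ⟨j, hjS, ?_⟩
        rw [Pi.sub_apply, eq_zero_of_supp_subset hz hjT, sub_zero, norm_pos_iff]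
        exact mem_supp.1 hjS
      exact pos_of_mul_pos_right (h2.trans_le h1) (Nat.cast_nonneg _)
    have hK : (0 : ℝ) < S.card := by exact_mod_cast (Nat.zero_le t).trans_lt ht
    obtain ⟨i, hiS, hi⟩ := exists_norm_le_corr_of_coherence hunit hcoh ⟨j, hjS⟩ hrc
    have hcpos : 0 < corr A r i := (div_pos hpos hK).trans_le hi
    refine ⟨i, hiS, fun hiT => ?_, hcpos, fun n hn => ?_⟩
    -- Selected columns are orthogonal to the residual, hence i is new.
    · have horth : inner ℂ (ecol A i) (WithLp.toLp 2 r) = 0 := by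
        rw [hres]
        exact Submodule.sub_starProjection_mem_orthogonal (K := colSpan A T) _ _
          (Submodule.subset_span ⟨i, hiT, rfl⟩)
      rw [corr_eq_norm_inner, horth, norm_zero] at hcpos
      exact hcpos.false
    · exact (hout t ht n hn r (by rw [hr, heq]) hpos).trans_le hi
  -- Agreement with the oracle must be carried along: `hout` speaks only of oracle residuals.
  have hind : ∀ t ≤ S.card, omp τ A y t = omp τ (restrictCols S A) y t ∧
      (omp τ A y t).1 ⊆ S ∧ (omp τ A y t).1.card = t := by
    intro t
    induction t with
    | zero => intro _; simp [omp]
    | succ t ih =>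
      intro ht
      obtain ⟨heq, hsub, hcard⟩ := ih (by lia)
      obtain ⟨i, hiS, hiT, hpos, hlt⟩ := hgreedy t ht heq hsub hcard
      have hmax := maximizers_restrictCols hiS hiT hlt
      have hτmem := hτ (omp τ A y t).1 _ (maximizers_nonempty A (omp τ A y t).2 hiT)
      have hτS := maximizers_subset hiT hlt hτmem
      have hτT := (mem_maximizers.1 hτmem).1
      have hfst : (omp τ A y (t + 1)).1 = (omp τ (restrictCols S A) y (t + 1)).1 := by
        simp only [omp]
        rw [← heq, hmax]
      have hsub' : (omp τ A y (t + 1)).1 ⊆ S := Finset.insert_subset hτS hsub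
      refine ⟨Prod.ext hfst ?_, hsub', ?_⟩
      · apply WithLp.toLp_injective 2
        rw [toLp_omp_snd, toLp_omp_snd, ← hfst, lsResidual_restrictCols A hsub']
      · simp only [omp]
        rw [Finset.card_insert_of_notMem hτT, hcard]
  refine ⟨?_, fun t ht => ?_⟩
  · obtain ⟨-, hsub, hcard⟩ := hind S.card le_rfl
    exact Finset.eq_of_subset_of_card_le hsub hcard.ge
  · obtain ⟨heq, hsub, hcard⟩ := hind t ht.le
    obtain ⟨i, hiS, -, hpos, hlt⟩ := hgreedy t ht heq hsub hcard
    exact greedyCondition_of_corr_lt hiS hpos hlt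

/-! ### Measurability of the pursuit -/

section Measurability

variable {α : Type*} [MeasurableSpace α] {A : α → Matrix (Fin M) (Fin N) ℂ}

theorem measurable_ecol (hA : ∀ m n, Measurable fun a => A a m n) (n : Fin N) :
    Measurable fun a => ecol (A a) n := by
  unfold ecol
  exact (WithLp.measurable_toLp 2 _).comp (measurable_pi_lambda _ fun m => hA m n)

theorem lsResidual_sub (B : Matrix (Fin M) (Fin N) ℂ) (T : Finset (Fin N))
    (u v : EuclideanSpace ℂ (Fin M)) :
    lsResidual B T (u - v) = lsResidual B T u - lsResidual B T v := by
  simp only [lsResidual, map_sub]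
  abel

theorem lsResidual_smul (B : Matrix (Fin M) (Fin N) ℂ) (T : Finset (Fin N)) (c : ℂ)
    (u : EuclideanSpace ℂ (Fin M)) : lsResidual B T (c • u) = c • lsResidual B T u := by
  simp only [lsResidual, map_smul, smul_sub]

theorem lsResidual_add (B : Matrix (Fin M) (Fin N) ℂ) (T : Finset (Fin N))
    (u v : EuclideanSpace ℂ (Fin M)) :
    lsResidual B T (u + v) = lsResidual B T u + lsResidual B T v := by
  simp only [lsResidual, map_add]
  abel

theorem norm_lsResidual_le (B : Matrix (Fin M) (Fin N) ℂ) {T : Finset (Fin N)}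
    (u : EuclideanSpace ℂ (Fin M)) {w : EuclideanSpace ℂ (Fin M)} (hw : w ∈ colSpan B T) :
    ‖lsResidual B T u‖ ≤ ‖u - w‖ := by
  rw [lsResidual, Submodule.starProjection_minimal]
  exact ciInf_le ⟨0, by rintro _ ⟨v, rfl⟩; exact norm_nonneg _⟩ (⟨w, hw⟩ : colSpan B T)

/-- The distance to the span is an infimum over a countable dense set of coefficients; this gives
measurability in B even where the rank jumps. -/
theorem norm_lsResidual_lt_iff (B : Matrix (Fin M) (Fin N) ℂ) (T : Finset (Fin N))
    (u : EuclideanSpace ℂ (Fin M)) (c : ℝ) :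
    ‖lsResidual B T u‖ < c ↔
      ∃ k, ‖u - ∑ n ∈ T, TopologicalSpace.denseSeq (Fin N → ℂ) k n • ecol B n‖ < c := by
  constructor
  · intro h
    obtain ⟨z, hz⟩ := (Submodule.mem_span_image_finset_iff_exists_fun' ℂ).1
      ((colSpan B T).starProjection_apply_mem u)
    have hopen : IsOpen {z : Fin N → ℂ | ‖u - ∑ n ∈ T, z n • ecol B n‖ < c} :=
      isOpen_lt (by fun_prop) continuous_const
    obtain ⟨_, hz', k, rfl⟩ := (TopologicalSpace.denseRange_denseSeq
      (Fin N → ℂ)).inter_open_nonempty _ hopen ⟨z, by rw [Set.mem_ofPred_eq, hz]; exact h⟩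
    exact ⟨k, hz'⟩
  · rintro ⟨k, hk⟩
    refine (norm_lsResidual_le B u ?_).trans_lt hk
    exact Submodule.sum_mem _ fun n hn =>
      Submodule.smul_mem _ _ (Submodule.subset_span ⟨n, hn, rfl⟩)

theorem measurable_norm_lsResidual (hA : ∀ m n, Measurable fun a => A a m n)
    (T : Finset (Fin N)) {u : α → EuclideanSpace ℂ (Fin M)} (hu : Measurable u) :
    Measurable fun a => ‖lsResidual (A a) T (u a)‖ := by
  have hcol := measurable_ecol hA
  refine measurable_of_Iio fun c => ?_
  have h : (fun a => ‖lsResidual (A a) T (u a)‖) ⁻¹' Set.Iio c = ⋃ k, {a | ‖u a -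
      ∑ n ∈ T, TopologicalSpace.denseSeq (Fin N → ℂ) k n • ecol (A a) n‖ < c} := by
    ext a
    simp [norm_lsResidual_lt_iff]
  rw [h]
  exact MeasurableSet.iUnion fun k => measurableSet_lt (by fun_prop) measurable_const

theorem inner_lsResidual_lsResidual (B : Matrix (Fin M) (Fin N) ℂ) (T : Finset (Fin N))
    (u v : EuclideanSpace ℂ (Fin M)) :
    inner ℂ (lsResidual B T v) (lsResidual B T u) = inner ℂ v (lsResidual B T u) := by
  have h : inner ℂ ((colSpan B T).starProjection v) (lsResidual B T u) = 0 :=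
    Submodule.sub_starProjection_mem_orthogonal (K := colSpan B T) u _
      ((colSpan B T).starProjection_apply_mem v)
  nth_rewrite 1 [lsResidual]
  rw [inner_sub_left, h, sub_zero]

/-- Each coordinate is an inner product of two residuals, and polarization writes it through
residual norms. -/
theorem measurable_ofLp_lsResidual (hA : ∀ m n, Measurable fun a => A a m n)
    (T : Finset (Fin N)) {u : α → EuclideanSpace ℂ (Fin M)} (hu : Measurable u) :
    Measurable fun a => WithLp.ofLp (lsResidual (A a) T (u a)) := by
  refine measurable_pi_lambda _ fun m => ?_
  have h : ∀ a, WithLp.ofLp (lsResidual (A a) T (u a)) m =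
      inner ℂ (lsResidual (A a) T (EuclideanSpace.single m 1)) (lsResidual (A a) T (u a)) := by
    intro a
    rw [inner_lsResidual_lsResidual, EuclideanSpace.inner_single_left]
    simp
  simp_rw [h, inner_eq_sum_norm_sq_div_four, ← lsResidual_smul, ← lsResidual_sub,
    ← lsResidual_add]
  have hm := fun v : α → EuclideanSpace ℂ (Fin M) => measurable_norm_lsResidual hA T (u := v)
  have h1 := hm (fun a => EuclideanSpace.single m 1 + u a) (by fun_prop)
  have h2 := hm (fun a => EuclideanSpace.single m 1 - u a) (by fun_prop)
  have h3 := hm (fun a => EuclideanSpace.single m 1 - (RCLike.I : ℂ) • u a) (by fun_prop)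
  have h4 := hm (fun a => EuclideanSpace.single m 1 + (RCLike.I : ℂ) • u a) (by fun_prop)
  simp only [RCLike.ofReal_eq_complex_ofReal]
  fun_prop

theorem measurable_corr (hA : ∀ m n, Measurable fun a => A a m n) {r : α → Fin M → ℂ}
    (hr : Measurable r) (n : Fin N) : Measurable fun a => corr (A a) (r a) n := by
  have : ∀ m, Measurable fun a => r a m := fun m => (measurable_pi_apply m).comp hr
  have : ∀ m, Measurable fun a => star (A a m n) := fun m =>
    continuous_star.measurable.comp (hA m n)
  simp only [corr, dotProduct, Matrix.col_apply, Pi.star_apply]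
  fun_prop

theorem measurableSet_maximizers_eq (hA : ∀ m n, Measurable fun a => A a m n)
    {r : α → Fin M → ℂ} (hr : Measurable r) (T s : Finset (Fin N)) :
    MeasurableSet {a | maximizers (A a) (r a) T = s} := by
  simp only [Finset.ext_iff, mem_maximizers, Set.ofPred_forall]
  refine MeasurableSet.iInter fun n => MeasurableSet.iff ?_ (.const _)
  refine (MeasurableSet.const (n ∉ T)).inter ?_
  change MeasurableSet {a | ∀ k ∉ T, corr (A a) (r a) k ≤ corr (A a) (r a) n}
  simp only [Set.ofPred_forall]
  exact MeasurableSet.iInter fun k => MeasurableSet.iInter fun _ =>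
    measurableSet_le (measurable_corr hA hr k) (measurable_corr hA hr n)

variable (τ : Finset (Fin N) → Finset (Fin N) → Fin N)

theorem measurable_omp_snd_of_fst (hA : ∀ m n, Measurable fun a => A a m n)
    {y : α → Fin M → ℂ} (hy : Measurable y) {t : ℕ}
    (h : ∀ T, MeasurableSet {a | (omp τ (A a) (y a) t).1 = T}) :
    Measurable fun a => (omp τ (A a) (y a) t).2 := by
  intro s hs
  have heq : (fun a => (omp τ (A a) (y a) t).2) ⁻¹' s =
      ⋃ T, {a | (omp τ (A a) (y a) t).1 = T} ∩
        (fun a => WithLp.ofLp (lsResidual (A a) T (WithLp.toLp 2 (y a)))) ⁻¹' s := by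
    ext a
    simp [← toLp_omp_snd]
  rw [heq]
  exact MeasurableSet.iUnion fun T => (h T).inter
    (measurable_ofLp_lsResidual hA T ((WithLp.measurable_toLp 2 _).comp hy) hs)

theorem measurableSet_omp_fst_eq (hA : ∀ m n, Measurable fun a => A a m n)
    {y : α → Fin M → ℂ} (hy : Measurable y) (t : ℕ) (T : Finset (Fin N)) :
    MeasurableSet {a | (omp τ (A a) (y a) t).1 = T} := by
  induction t generalizing T with
  | zero => exact .const (∅ = T)
  | succ t ih =>
    have hr := measurable_omp_snd_of_fst τ hA hy ih
    have heq : {a | (omp τ (A a) (y a) (t + 1)).1 = T} =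
        ⋃ U, ⋃ s, {a | (omp τ (A a) (y a) t).1 = U} ∩
          ({a | maximizers (A a) (omp τ (A a) (y a) t).2 U = s} ∩
            {_a | insert (τ U s) U = T}) := by
      ext a
      simp [omp]
    rw [heq]
    exact MeasurableSet.iUnion fun U => MeasurableSet.iUnion fun s =>
      (ih U).inter ((measurableSet_maximizers_eq hA hr U s).inter (.const _))

theorem measurable_omp_snd (hA : ∀ m n, Measurable fun a => A a m n)
    {y : α → Fin M → ℂ} (hy : Measurable y) (t : ℕ) :
    Measurable fun a => (omp τ (A a) (y a) t).2 :=
  measurable_omp_snd_of_fst τ hA hy (measurableSet_omp_fst_eq τ hA hy t)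

end Measurability

/-! ### Independence and the union bound -/

theorem measurable_rprMatrix (m : Fin M) (n : Fin N) :
    Measurable fun θ : Fin M → Fin N → ℝ => rprMatrix θ m n := by
  have : Measurable fun θ : Fin M → Fin N → ℝ => θ m n := by fun_prop
  simp only [rprMatrix, Matrix.of_apply]
  fun_prop

theorem measurable_l2norm : Measurable (l2norm : (Fin M → ℂ) → ℝ) :=
  measurable_norm.comp (WithLp.measurable_toLp 2 _)

theorem l2norm_sq (r : Fin M → ℂ) : l2norm r ^ 2 = ∑ m, ‖r m‖ ^ 2 := by
  rw [l2norm, EuclideanSpace.norm_sq_eq]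

theorem norm_ecol_rprMatrix (hM : 0 < M) (θ : Fin M → Fin N → ℝ) (n : Fin N) :
    ‖ecol (rprMatrix θ) n‖ = 1 := by
  have h := l2norm_sq ((rprMatrix θ).col n)
  have hM' : (0 : ℝ) < M := by exact_mod_cast hM
  have h1 : ∀ m, ‖(rprMatrix θ).col n m‖ ^ 2 = 1 / M := by
    intro m
    simp only [Matrix.col_apply, rprMatrix, Matrix.of_apply]
    rw [norm_mul, mul_comm Complex.I, Complex.norm_exp_ofReal_mul_I, mul_one, Complex.norm_real,
      Real.norm_eq_abs, sq_abs, div_pow, Real.sq_sqrt hM'.le, one_pow]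
  simp only [h1, Finset.sum_const, Finset.card_univ, Fintype.card_fin, nsmul_eq_mul] at h
  rw [mul_one_div_cancel hM'.ne'] at h
  exact (pow_eq_one_iff_of_nonneg (norm_nonneg _) two_ne_zero).1 h

theorem corr_rprMatrix (θ : Fin M → Fin N → ℝ) (r : Fin M → ℂ) (n : Fin N) :
    corr (rprMatrix θ) r n =
      ‖∑ m, star (Complex.exp (Complex.I * θ m n)) * (((1 / √(M : ℝ) : ℝ) : ℂ) * r m)‖ := by
  rw [corr, dotProduct]
  congr 1
  refine Finset.sum_congr rfl fun m _ => ?_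
  simp only [Pi.star_apply, Matrix.col_apply, rprMatrix, Matrix.of_apply, star_mul']
  rw [show star (((1 / √(M : ℝ) : ℝ) : ℂ)) = ((1 / √(M : ℝ) : ℝ) : ℂ) from Complex.conj_ofReal _]
  ring

theorem measure_corr_ge_le_of_const {Ω : Type*} [MeasurableSpace Ω] {P : Measure Ω}
    [IsProbabilityMeasure P] {U : Fin M → Ω → ℝ} (hm : ∀ m, Measurable (U m))
    (hU : ∀ m, pdf.IsUniform (U m) (Set.Ico 0 (2 * Real.pi)) P volume) (hind : iIndepFun U P)
    {K : ℕ} {g : ℝ} (hg : 2 < g) (r : Fin M → ℂ) :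
    P {ω | 0 < l2norm r ∧ l2norm r / K ≤
        ‖∑ m, star (Complex.exp (Complex.I * U m ω)) * (((1 / √(M : ℝ) : ℝ) : ℂ) * r m)‖} ≤
      ENNReal.ofReal ((1 - 2 / g) ^ (-(1 / 2) : ℝ) *
        Real.exp (-(M / (g * (K : ℝ) ^ 2)))) := by
  by_cases hr : 0 < l2norm r
  swap
  · simp [hr]
  have hM : (0 : ℝ) < M := by
    rcases Nat.eq_zero_or_pos M with rfl | h
    · have := l2norm_sq r
      simp at this
      exact absurd this hr.ne'
    · exact_mod_cast h
  have hL : ∑ m, ‖((1 / √(M : ℝ) : ℝ) : ℂ) * r m‖ ^ 2 = l2norm r ^ 2 / M := by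
    rw [l2norm_sq, Finset.sum_div]
    refine Finset.sum_congr rfl fun m _ => ?_
    rw [norm_mul, Complex.norm_real, Real.norm_eq_abs, mul_pow, sq_abs, div_pow,
      Real.sq_sqrt hM.le]
    ring
  -- The weights r/√M have norm ‖r‖/√M, so the threshold ‖r‖/K is δ = √M/K times that norm.
  have h := measure_norm_sum_phase_ge_le hm hU hind
    (fun m => ((1 / √(M : ℝ) : ℝ) : ℂ) * r m) (δ := √M / K) hg (by positivity)
    (by rw [hL]; positivity)
  have e1 : √(M : ℝ) / K * √(l2norm r ^ 2 / M) = l2norm r / K := by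
    rw [Real.sqrt_div (by positivity), Real.sqrt_sq hr.le]
    have : √(M : ℝ) ≠ 0 := by positivity
    field_simp
  have e2 : (√(M : ℝ) / K) ^ 2 / g = M / (g * (K : ℝ) ^ 2) := by
    rw [div_pow, Real.sq_sqrt hM.le, div_div, mul_comm]
  rw [hL, e1, e2] at h
  simpa [hr] using h

/-- A column is unlikely to correlate much with a vector that depends on the other columns. -/
theorem measure_corr_ge_le {Ω : Type*} [MeasurableSpace Ω] {P : Measure Ω}
    [IsProbabilityMeasure P] {Θ : Fin M → Fin N → Ω → ℝ} (hmeas : ∀ m n, Measurable (Θ m n))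
    (hunif : ∀ m n, pdf.IsUniform (Θ m n) (Set.Ico 0 (2 * Real.pi)) P volume)
    (hindep : iIndepFun (fun (p : Fin M × Fin N) => Θ p.1 p.2) P) {K : ℕ} {g : ℝ} (hg : 2 < g)
    (n : Fin N) {R : (Fin M → Fin N → ℝ) → Fin M → ℂ} (hRm : Measurable R)
    (hR : ∀ θ θ', (∀ m, ∀ k ≠ n, θ m k = θ' m k) → R θ = R θ') :
    P {ω | 0 < l2norm (R fun m k => Θ m k ω) ∧ l2norm (R fun m k => Θ m k ω) / K ≤
        corr (rprMatrix fun m k => Θ m k ω) (R fun m k => Θ m k ω) n} ≤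
      ENNReal.ofReal ((1 - 2 / g) ^ (-(1 / 2) : ℝ) *
        Real.exp (-(M / (g * (K : ℝ) ^ 2)))) := by
  set U : Ω → Fin M → ℝ := fun ω m => Θ m n ω with hU
  -- R sees the phases only through V, which is independent of column n; Fubini then freezes R.
  set V : Ω → Fin M → Fin N → ℝ := fun ω m k => if k = n then 0 else Θ m k ω with hV
  have hUm : Measurable U := measurable_pi_lambda _ fun m => hmeas m n
  have hVm : Measurable V := measurable_pi_lambda _ fun m => measurable_pi_lambda _ fun k => by
    by_cases hk : k = n
    · simp [V, hk]
    · simpa [V, hk] using hmeas m k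
  have hUV : IndepFun U V P := by
    let s : Finset (Fin M × Fin N) := Finset.univ.filter fun p => p.2 = n
    let s' : Finset (Fin M × Fin N) := Finset.univ.filter fun p => p.2 ≠ n
    have hd : Disjoint s s' := by
      rw [Finset.disjoint_left]
      intro p hp hp'
      simp [s, s'] at hp hp'
      exact hp' hp
    have h := hindep.indepFun_finset s s' hd fun p => hmeas p.1 p.2
    refine h.comp (φ := fun f m => f ⟨(m, n), by simp [s]⟩)
      (ψ := fun f m k => if hk : k = n then 0 else f ⟨(m, k), by simp [s', hk]⟩) ?_ ?_
    · fun_prop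
    · refine measurable_pi_lambda _ fun m => measurable_pi_lambda _ fun k => ?_
      by_cases hk : k = n
      · simp [hk]
      · simp only [hk, dite_false]
        fun_prop
  have hRV : ∀ ω, R (fun m k => Θ m k ω) = R (V ω) := fun ω =>
    hR _ _ fun m k hk => by simp [V, hk]
  let B : Set ((Fin M → ℝ) × (Fin M → Fin N → ℝ)) := {q | 0 < l2norm (R q.2) ∧
    l2norm (R q.2) / K ≤ ‖∑ m, star (Complex.exp (Complex.I * (q.1 m : ℂ))) *
      (((1 / √(M : ℝ) : ℝ) : ℂ) * R q.2 m)‖}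
  have hB : MeasurableSet B := by
    have h1 : Measurable fun q : (Fin M → ℝ) × (Fin M → Fin N → ℝ) => l2norm (R q.2) :=
      measurable_l2norm.comp (hRm.comp measurable_snd)
    have h2 : ∀ m, Measurable fun q : (Fin M → ℝ) × (Fin M → Fin N → ℝ) => R q.2 m :=
      fun m => (measurable_pi_apply m).comp (hRm.comp measurable_snd)
    have h3 : Measurable fun q : (Fin M → ℝ) × (Fin M → Fin N → ℝ) =>
        ‖∑ m, star (Complex.exp (Complex.I * (q.1 m : ℂ))) *
          (((1 / √(M : ℝ) : ℝ) : ℂ) * R q.2 m)‖ := by fun_prop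
    exact (measurableSet_lt measurable_const h1).inter
      (measurableSet_le (h1.div_const _) h3)
  have hset : {ω | 0 < l2norm (R fun m k => Θ m k ω) ∧ l2norm (R fun m k => Θ m k ω) / K ≤
      corr (rprMatrix fun m k => Θ m k ω) (R fun m k => Θ m k ω) n} =
      (fun ω => (U ω, V ω)) ⁻¹' B := by
    ext ω
    simp only [corr_rprMatrix, hRV, B, Set.mem_ofPred_eq, Set.mem_preimage, hU]
  have : IsProbabilityMeasure (P.map V) := Measure.isProbabilityMeasure_map hVm.aemeasurable
  have : IsProbabilityMeasure (P.map U) := Measure.isProbabilityMeasure_map hUm.aemeasurable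
  rw [hset, ← Measure.map_apply (hUm.prodMk hVm) hB,
    (indepFun_iff_map_prod_eq_prod_map_map hUm.aemeasurable hVm.aemeasurable).1 hUV,
    Measure.prod_apply_symm hB]
  refine (lintegral_mono (g := fun _ => ENNReal.ofReal ((1 - 2 / g) ^ (-(1 / 2) : ℝ) *
        Real.exp (-(M / (g * (K : ℝ) ^ 2))))) fun v => ?_).trans_eq (by simp)
  rw [Measure.map_apply hUm (measurable_prodMk_right hB)]
  exact measure_corr_ge_le_of_const (fun m => hmeas m n) (fun m => hunif m n)
    (hindep.precomp (g := fun m => (m, n)) fun m m' h => (Prod.ext_iff.1 h).1) hg (R v)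

theorem le_measureReal_ssd {Ω : Type*} [MeasurableSpace Ω] {P : Measure Ω}
    [IsProbabilityMeasure P] {Θ : Fin M → Fin N → Ω → ℝ} (hmeas : ∀ m n, Measurable (Θ m n))
    (hunif : ∀ m n, pdf.IsUniform (Θ m n) (Set.Ico 0 (2 * Real.pi)) P volume)
    (hindep : iIndepFun (fun (p : Fin M × Fin N) => Θ p.1 p.2) P) (hM : 0 < M)
    (x : Fin N → ℂ) {τ : Finset (Fin N) → Finset (Fin N) → Fin N} (hτ : IsTieBreak τ)
    {g : ℝ} (hg : 2 < g) :
    1 - (1 - 2 / g) ^ (-(1 / 2) : ℝ) * ((supp x).card * N) *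
        Real.exp (-(M / (g * ((supp x).card : ℝ) ^ 2))) ≤
      P.real {ω | SSD τ (rprMatrix fun m n => Θ m n ω) x (supp x).card} := by
  set S := supp x with hS
  set K := S.card with hK
  let e : Fin K ≃ S := (S.equivFinOfCardEq rfl).symm
  -- K test vectors per column: the support columns if n ∈ S, the oracle residuals otherwise. A
  -- column paired with itself gets 0, whose bad event is empty.
  let R : Fin N → Fin K → (Fin M → Fin N → ℝ) → Fin M → ℂ := fun n t θ =>
    if n ∈ S then (if (e t : Fin N) = n then 0 else (rprMatrix θ).col (e t))
    else (omp τ (restrictCols S (rprMatrix θ)) ((restrictCols S (rprMatrix θ)).mulVec x) t).2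
  have hRm : ∀ n t, Measurable (R n t) := by
    intro n t
    by_cases hn : n ∈ S
    · by_cases ht : (e t : Fin N) = n
      · simp only [R, hn, ht, if_true]
        exact measurable_const
      · simp only [R, hn, ht, if_true, if_false]
        exact measurable_pi_lambda _ fun m => measurable_rprMatrix m _
    · simp only [R, hn, if_false]
      have hA : ∀ m k, Measurable fun θ : Fin M → Fin N → ℝ =>
          restrictCols S (rprMatrix θ) m k := by
        intro m k
        by_cases hk : k ∈ S
        · simpa [restrictCols, hk] using measurable_rprMatrix m k
        · simp [restrictCols, hk]
      refine measurable_omp_snd τ hA (measurable_pi_lambda _ fun m => ?_) t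
      simp only [Matrix.mulVec, dotProduct]
      fun_prop
  have hRdep : ∀ n t θ θ', (∀ m, ∀ k ≠ n, θ m k = θ' m k) → R n t θ = R n t θ' := by
    intro n t θ θ' h
    by_cases hn : n ∈ S
    · by_cases ht : (e t : Fin N) = n
      · simp only [R, hn, ht, if_true]
      · simp only [R, hn, ht, if_true, if_false]
        ext m
        simp [rprMatrix, h m _ ht]
    · have : restrictCols S (rprMatrix θ) = restrictCols S (rprMatrix θ') := by
        ext m k
        by_cases hk : k ∈ S
        · have hkn : k ≠ n := fun h => hn (h ▸ hk)
          simp [restrictCols, rprMatrix, h m k hkn]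
        · simp [restrictCols, hk]
      simp only [R, hn, if_false, this]
  let E : Fin N → Fin K → Set Ω := fun n t => {ω | 0 < l2norm (R n t fun m k => Θ m k ω) ∧
    l2norm (R n t fun m k => Θ m k ω) / K ≤
      corr (rprMatrix fun m k => Θ m k ω) (R n t fun m k => Θ m k ω) n}
  set p : ℝ := (1 - 2 / g) ^ (-(1 / 2) : ℝ) * Real.exp (-(M / (g * (K : ℝ) ^ 2))) with hp
  have hp0 : 0 ≤ p := by
    have : 2 / g < 1 := (div_lt_one (by linarith)).2 hg
    have : 0 ≤ 1 - 2 / g := by linarith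
    positivity
  have hE : ∀ n t, P (E n t) ≤ ENNReal.ofReal p := fun n t =>
    measure_corr_ge_le hmeas hunif hindep hg n (hRm n t) (hRdep n t)
  set G : Set Ω := {ω | SSD τ (rprMatrix fun m n => Θ m n ω) x K} with hG
  have hcover : (Set.univ : Set Ω) ⊆ G ∪ ⋃ n, ⋃ t, E n t := by
    intro ω _
    by_contra hω
    simp only [Set.mem_union, Set.mem_iUnion, not_or, not_exists] at hω
    obtain ⟨hωG, hωE⟩ := hω
    have hunit := norm_ecol_rprMatrix hM (fun m n => Θ m n ω)
    refine hωG (ssd_of_coherence hτ hunit (fun i hi k hk hik => ?_)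
      fun t ht n hn r hr hpos => ?_)
    · have h := hωE i (e.symm ⟨k, hk⟩)
      simp only [E, R, hS, hi, if_true, Equiv.apply_symm_apply, hik.symm, if_false,
        Set.mem_ofPred_eq, not_and, not_le, corr_eq_norm_inner, l2norm] at h
      change (0 : ℝ) < ‖ecol _ k‖ → ‖inner ℂ _ (ecol _ k)‖ < ‖ecol _ k‖ / _ at h
      rw [hunit k] at h
      exact (h one_pos).le
    · have h := hωE n ⟨t, ht⟩
      simp only [E, R, hS, hn, if_false, Set.mem_ofPred_eq, not_and, not_le] at h
      rw [hr] at hpos ⊢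
      exact h hpos
  clear_value p
  -- Subadditivity of P on a cover suffices, so G need not be measurable.
  have hbound : (1 : ENNReal) ≤ P G + ENNReal.ofReal (K * N * p) := by
    calc (1 : ENNReal) = P Set.univ := measure_univ.symm
      _ ≤ P G + P (⋃ n, ⋃ t, E n t) := (measure_mono hcover).trans (measure_union_le _ _)
      _ ≤ P G + ∑ _n : Fin N, ∑ _t : Fin K, ENNReal.ofReal p := by
          gcongr
          refine (measure_iUnion_fintype_le _ _).trans (Finset.sum_le_sum fun n _ => ?_)
          exact (measure_iUnion_fintype_le _ _).trans (Finset.sum_le_sum fun t _ => hE n t)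
      _ = P G + ENNReal.ofReal (K * N * p) := by
          congr 1
          rw [ENNReal.ofReal_mul (by positivity), ENNReal.ofReal_mul (by positivity)]
          simp
          ring
  have hreal := ENNReal.toReal_mono (by finiteness) hbound
  rw [ENNReal.toReal_add (by finiteness) (by finiteness),
    ENNReal.toReal_ofReal (by positivity), ENNReal.toReal_one] at hreal
  change 1 ≤ P.real G + _ at hreal
  rw [hp] at hreal
  linarith

end RPR

end

theorem theorem2 {Ω : Type*} [MeasurableSpace Ω] (P : Measure Ω) [IsProbabilityMeasure P]
    (M N K : ℕ) (Θ : Fin M → Fin N → Ω → ℝ)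
    (hmeas : ∀ m n, Measurable (Θ m n))
    (hunif : ∀ m n, pdf.IsUniform (Θ m n) (Set.Ico 0 (2 * Real.pi)) P volume)
    (hindep : iIndepFun (fun (p : Fin M × Fin N) => Θ p.1 p.2) P)
    (x : Fin N → ℂ) (hx : (RPR.supp x).card = K)
    (τ : Finset (Fin N) → Finset (Fin N) → Fin N) (hτ : RPR.IsTieBreak τ)
    (g : ℝ) (hg : 2 < g) :
    P.real {ω | RPR.SSD τ (RPR.rprMatrix fun m n => Θ m n ω) x K} ≥
        1 - (1 - 2 / g) ^ (-(1 / 2) : ℝ) * (K * N) * Real.exp (-(M / (g * (K : ℝ) ^ 2))) ∧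
      ∀ ε : ℝ, 0 < ε → ε < 1 →
        (M : ℝ) ≥ g * (K : ℝ) ^ 2 * Real.log (K * N / (ε * √(1 - 2 / g))) →
        P.real {ω | RPR.SSD τ (RPR.rprMatrix fun m n => Θ m n ω) x K} ≥ 1 - ε := by
  have hg0 : 0 < g := by linarith
  have hlt : 2 / g < 1 := (div_lt_one hg0).2 hg
  have hq : 0 < 1 - 2 / g := by linarith
  have hpow : (1 - 2 / g) ^ (-(1 / 2) : ℝ) = (√(1 - 2 / g))⁻¹ := by
    rw [Real.rpow_neg hq.le, ← Real.sqrt_eq_rpow]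
  -- For K = 0 the exponent divides by zero, but the factor K kills the error term and the empty
  -- pursuit succeeds surely.
  rcases Nat.eq_zero_or_pos K with hK | hK
  · subst hK
    have hall : {ω | RPR.SSD τ (RPR.rprMatrix fun m n => Θ m n ω) x 0} = Set.univ := by
      ext ω
      simp [RPR.SSD, RPR.omp, Finset.card_eq_zero.1 hx]
    rw [hall]
    refine ⟨by simp, fun ε hε _ _ => ?_⟩
    simp only [probReal_univ]
    linarith
  have hN : 0 < N := hK.trans_le (by rw [← hx]; simpa using Finset.card_le_univ (RPR.supp x))
  have hK' : (1 : ℝ) ≤ K := by exact_mod_cast hK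
  have hN' : (1 : ℝ) ≤ N := by exact_mod_cast hN
  have hs : 0 < √(1 - 2 / g) := Real.sqrt_pos.2 hq
  have hmain : P.real {ω | RPR.SSD τ (RPR.rprMatrix fun m n => Θ m n ω) x K} ≥
      1 - (1 - 2 / g) ^ (-(1 / 2) : ℝ) * (K * N) * Real.exp (-(M / (g * (K : ℝ) ^ 2))) := by
    -- For M = 0 columns do not have unit norm; the bound is then at most 0.
    rcases Nat.eq_zero_or_pos M with hM | hM
    · subst hM
      have h1 : (1 : ℝ) ≤ (1 - 2 / g) ^ (-(1 / 2) : ℝ) :=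
        Real.one_le_rpow_of_pos_of_le_one_of_nonpos hq
          (by have : 0 < 2 / g := by positivity
              linarith) (by norm_num)
      have h2 : (1 : ℝ) ≤ (1 - 2 / g) ^ (-(1 / 2) : ℝ) * (K * N) :=
        one_le_mul_of_one_le_of_one_le h1 (one_le_mul_of_one_le_of_one_le hK' hN')
      refine le_trans ?_ measureReal_nonneg
      simpa using h2
    · subst hx
      exact RPR.le_measureReal_ssd hmeas hunif hindep hM x hτ hg
  refine ⟨hmain, fun ε hε _ hMε => le_trans ?_ hmain⟩
  -- The hypothesis on M says exactly that the exponential is at most 1/q, and the prefactor is εq.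
  set q : ℝ := K * N / (ε * √(1 - 2 / g)) with hqdef
  have hq0 : 0 < q := by positivity
  have hlog : Real.log q ≤ M / (g * (K : ℝ) ^ 2) := by
    rw [le_div_iff₀ (by positivity), mul_comm]
    exact hMε
  have hexp : Real.exp (-(M / (g * (K : ℝ) ^ 2))) ≤ q⁻¹ := by
    rw [← Real.exp_log hq0, ← Real.exp_neg]
    exact Real.exp_le_exp.2 (neg_le_neg hlog)
  have hfin : (1 - 2 / g) ^ (-(1 / 2) : ℝ) * (K * N) * q⁻¹ = ε := by
    rw [hpow, hqdef]
    generalize √(1 - 2 / g) = s at hs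
    field_simp
  have := mul_le_mul_of_nonneg_left hexp
    (show 0 ≤ (1 - 2 / g) ^ (-(1 / 2) : ℝ) * (K * N : ℝ) by positivity)
  linarith
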